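/- **Setting.** All Hilbert spaces are finite-dimensional and nonzero, with fixed orthonormal bases. There are finitely many local agents $A_i$ with input and output message spaces $\mathcal H^{A_i^I},\mathcal H^{A_i^O}$, a global past with space $\mathcal H^P$ and a global future with space $\mathcal H^F$. Let $\mathcal T$ be a finite partially ordered set of positions. Each agent has input positions $\mathcal T_i^I\subseteq\mathcal T$, output positions $\mathcal T_i^O\subseteq\mathcal T$ and a bijection $\mathcal O_i:\mathcal T_i^I\to\mathcal T_i^O$ with $\mathcal O_i(t)>t$. The global past sends exactly one message, at a least element $t_P$ of $\mathcal T$; the global future receives exactly one message, at a greatest element $t_F$. The wire of $A_i$ at a position $t$ has the space $\mathcal H^{\bar A_i^{I/O}}=\mathbb C|\Omega\rangle\oplus\mathcal H^{A_i^{I/O}}$ (vacuum or one message). A *local operation* of $A_i$ is a map $\mathcal M_i=\bigotimes_{t\in\mathcal T_i^I}\mathcal M_i^t$, where each $\mathcal M_i^t$ is a completely positive trace-nonincreasing map from the operators on the input wire at $t$ to those on the output wire at $\mathcal O_i(t)$, with $\mathcal M_i^t(|\Omega\rangle\langle\Omega|)=|\Omega\rangle\langle\Omega|$ and mapping operators on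 $\mathcal H^{A_i^I}$ to operators on $\mathcal H^{A_i^O}$. We write $M_i$ for its Choi matrix and $*$ for the link product. A *process box* $\Phi$ on $\mathcal T$ is a completely positive trace-preserving map from the operators on $\mathcal H^P\otimes\bigotimes_{i,\,t\in\mathcal T_i^O}\mathcal H^{\bar A_i^O}$ to the operators on $\bigotimes_{i,\,t\in\mathcal T_i^I}\mathcal H^{\bar A_i^I}\otimes\mathcal H^F$ such that 1. (causality) there is a causality function $\chi$ on the cuts (lower sets) of $\mathcal T$ such that for every cut $\mathcal C$ the output of $\Phi$ at the positions in $\mathcal C$ is determined by the restriction of the input to the positions in $\chi(\mathcal C)$. Here a causality function satisfies $\chi(\mathcal C\cup\mathcal D)=\chi(\mathcal C)\cup\chi(\mathcal D)$; $\mathcal C\subseteq\mathcal D\Rightarrow\chi(\mathcal C)\subseteq\chi(\mathcal D)$; $\chi(\mathcal C)\subsetneq\mathcal C$ for bounded $\mathcal C\neq\emptyset$; and for bounded $\mathcal C$ and $t\in\mathcal C$ there is $n$ with $t\notin\chi^n(\mathcal C)$; 2. in composition with arbitrary local operations, each agent receives exactly one message in the whole run: every branch (obtained by projecting the agents' wires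 onto a fixed pattern of vacuum/non-vacuum) in which some agent does not receive exactly one message vanishes. $\Phi$ is *of simple form* if $\mathcal T=\{1,\dots,m\}$ with $m$ even, $t_P=1$, $t_F=m$, and for all agents $\mathcal T_i^I=\{2,4,\dots,m-2\}$, $\mathcal T_i^O=\{3,5,\dots,m-1\}$ and $\mathcal O_i(t)=t+1$. Process boxes $\Phi$ and $\Phi'$ are *operationally equivalent* if there are a one-to-one correspondence $A_i\leftrightarrow A_i'$ of their agents, maps $\mathcal M_i\mapsto\mathcal M_i'$ from the local operations of each $A_i$ to those of $A'_i$, and unitaries $U:\mathcal H^P\to\mathcal H^{P'}$, $V:\mathcal H^F\to\mathcal H^{F'}$ such that for all choices of local operations $$\Big(\bigotimes_i M'_i\Big)*\Phi'=(U\otimes V)\Big[\Big(\bigotimes_i M_i\Big)*\Phi\Big](U\otimes V)^\dagger .$$ **Lemma.** Let $\Phi$ be a process box of simple form with $\mathcal T=\{1,\dots,m\}$. Then there are $m'$ and a process box $\Phi'$ of simple form with $\mathcal T'=\{1,\dots,m'\}$, with the same agents, message spaces, global past and global future spaces, such that $\Phi$ is operationally equivalent to $\Phi'$ and at every $t\in\mathcal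 T'$ * $\Phi'$ sends at most one message (to all agents and the global future together), whatever input it receives; * $\Phi'$ receives at most one message (from all agents and the global past together) in composition with any local operations. -/

import Mathlib

open Matrix
open scoped Kronecker ComplexOrder

universe u v

noncomputable section

/-! ### Linear maps between matrix algebras -/

/-- The amplification `id ⊗ Φ` of a linear map `Φ` by a `k`-dimensional system. -/
def amplify {X Y : Type*} (Φ : Matrix X X ℂ →ₗ[ℂ] Matrix Y Y ℂ) (k : ℕ)
    (ρ : Matrix (Fin k × X) (Fin k × X) ℂ) : Matrix (Fin k × Y) (Fin k × Y) ℂ :=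
  Matrix.of fun u v => Φ (Matrix.of fun x x' => ρ (u.1, x) (v.1, x')) u.2 v.2

/-- Complete positivity: every amplification preserves positive semidefiniteness. -/
def IsCompletelyPositive {X Y : Type*} (Φ : Matrix X X ℂ →ₗ[ℂ] Matrix Y Y ℂ) : Prop :=
  ∀ (k : ℕ) (ρ : Matrix (Fin k × X) (Fin k × X) ℂ), ρ.PosSemidef → (amplify Φ k ρ).PosSemidef

def IsTracePreserving {X Y : Type*} [Fintype X] [Fintype Y]
    (Φ : Matrix X X ℂ →ₗ[ℂ] Matrix Y Y ℂ) : Prop :=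
  ∀ ρ, (Φ ρ).trace = ρ.trace

def IsTraceNonincreasing {X Y : Type*} [Fintype X] [Fintype Y]
    (Φ : Matrix X X ℂ →ₗ[ℂ] Matrix Y Y ℂ) : Prop :=
  ∀ ρ, ρ.PosSemidef → (Φ ρ).trace.re ≤ ρ.trace.re

/-- The Choi matrix `∑ |x⟩⟨x'| ⊗ Φ(|x⟩⟨x'|)`. -/
def choi {X Y : Type*} [DecidableEq X] (Φ : Matrix X X ℂ →ₗ[ℂ] Matrix Y Y ℂ) :
    Matrix (X × Y) (X × Y) ℂ :=
  Matrix.of fun u v => Φ (Matrix.single u.1 v.1 1) u.2 v.2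

/-- The link product `A * B = Tr_Y ((Aᵀ ⊗ 1) B) = ∑_{y,y'} A_{yy'} B_{yy'}` of an operator `A` on
the shared space `Y` and an operator `B` on `Y ⊗ Z`. -/
def linkProduct {Y Z : Type*} [Fintype Y] (A : Matrix Y Y ℂ) (B : Matrix (Y × Z) (Y × Z) ℂ) :
    Matrix Z Z ℂ :=
  Matrix.of fun z z' => ∑ y, ∑ y', A y y' * B (y, z) (y', z')

open Classical in
/-- Partial trace of an operator on `⊗_w B w`: the wires in `K` are kept, the others traced out. -/
def partialTrace {W : Type*} [Fintype W] [DecidableEq W] {B : W → Type*} [∀ w, Fintype (B w)]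
    (K : Set W) (ρ : Matrix (∀ w, B w) (∀ w, B w) ℂ) :
    Matrix (∀ w : {w // w ∈ K}, B w) (∀ w : {w // w ∈ K}, B w) ℂ :=
  Matrix.of fun x y => ∑ z : (∀ w : {w // w ∉ K}, B w),
    ρ ((Equiv.piEquivPiSubtypeProd (· ∈ K) B).symm (x, z))
      ((Equiv.piEquivPiSubtypeProd (· ∈ K) B).symm (y, z))

/-! ### Causality functions -/

/-- Cuts of the partially ordered set `T` are its lower sets. A cut is bounded if it lies below
some point of `T`. -/
def IsBoundedCut {T : Type*} [PartialOrder T] (C : LowerSet T) : Prop :=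
  ∃ t : T, C ≤ LowerSet.Iic t

structure IsCausalityFunction {T : Type*} [PartialOrder T] (χ : LowerSet T → LowerSet T) :
    Prop where
  union : ∀ C D, χ (C ⊔ D) = χ C ⊔ χ D
  mono : ∀ C D, C ≤ D → χ C ≤ χ D
  strict : ∀ C, IsBoundedCut C → C ≠ ⊥ → χ C < C
  exhaust : ∀ C, IsBoundedCut C → ∀ t ∈ C, ∃ n : ℕ, t ∉ χ^[n] C

/-! ### Agents and positions -/

/-- Finitely many local agents `A_i` with (nonzero, finite-dimensional) message spaces for their
inputs and outputs, together with the space of the global past and that of the global future. A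
space is given by the index type of its fixed orthonormal basis. -/
structure AgentSpaces where
  Agent : Type u
  Inp : Agent → Type u
  Out : Agent → Type u
  Past : Type u
  Future : Type u
  [agentFintype : Fintype Agent]
  [agentDecEq : DecidableEq Agent]
  [inpFintype : ∀ i, Fintype (Inp i)]
  [inpDecEq : ∀ i, DecidableEq (Inp i)]
  [inpNonempty : ∀ i, Nonempty (Inp i)]
  [outFintype : ∀ i, Fintype (Out i)]
  [outDecEq : ∀ i, DecidableEq (Out i)]
  [outNonempty : ∀ i, Nonempty (Out i)]
  [pastFintype : Fintype Past]
  [pastDecEq : DecidableEq Past]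
  [pastNonempty : Nonempty Past]
  [futureFintype : Fintype Future]
  [futureDecEq : DecidableEq Future]
  [futureNonempty : Nonempty Future]

attribute [instance] AgentSpaces.agentFintype AgentSpaces.agentDecEq AgentSpaces.inpFintype
  AgentSpaces.inpDecEq AgentSpaces.inpNonempty AgentSpaces.outFintype AgentSpaces.outDecEq
  AgentSpaces.outNonempty AgentSpaces.pastFintype AgentSpaces.pastDecEq AgentSpaces.pastNonempty
  AgentSpaces.futureFintype AgentSpaces.futureDecEq AgentSpaces.futureNonempty

/-- The positions, in the partially ordered set `T`, at which the agents act: the input positions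
`𝒯ᴵ_i`, the output positions `𝒯ᴼ_i`, the bijection `𝒪_i : 𝒯ᴵ_i → 𝒯ᴼ_i` with `𝒪_i(t) > t`, the
position at which the global past sends and the one at which the global future receives. -/
structure Positions (A : AgentSpaces.{u}) (T : Type v) [PartialOrder T] where
  inp : A.Agent → Finset T
  out : A.Agent → Finset T
  resp : ∀ i, inp i ≃ out i
  lt_resp : ∀ i (t : inp i), (t : T) < (resp i t : T)
  past : T
  past_le : ∀ t, past ≤ t
  future : T
  le_future : ∀ t, t ≤ future

namespace Positions

variable {A : AgentSpaces.{u}} {T : Type v} [PartialOrder T] [DecidableEq T]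

/-- The wires (one for each agent and each of its input positions) from the process box to the
agents. -/
abbrev InWire (L : Positions A T) : Type (max u v) := Σ i : A.Agent, {t // t ∈ L.inp i}

/-- The wires from the agents to the process box. -/
abbrev OutWire (L : Positions A T) : Type (max u v) := Σ i : A.Agent, {t // t ∈ L.out i}

/-- The wire on which an agent answers to the input on the wire `w`. -/
def answer (L : Positions A T) (w : L.InWire) : L.OutWire := ⟨w.1, L.resp w.1 w.2⟩

/-- Basis of all input wires of the agents, `⊗_i ⊗_{t ∈ 𝒯ᴵ_i} (ℂ|Ω⟩ ⊕ ℋ^{Aᴵ_i})`. The vacuum `Ω`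
is `none`, one message in the basis state `a` is `some a`. -/
abbrev AgentIn (L : Positions A T) : Type (max u v) := ∀ w : L.InWire, Option (A.Inp w.1)

/-- Basis of all output wires of the agents, `⊗_i ⊗_{t ∈ 𝒯ᴼ_i} (ℂ|Ω⟩ ⊕ ℋ^{Aᴼ_i})`. -/
abbrev AgentOut (L : Positions A T) : Type (max u v) := ∀ w : L.OutWire, Option (A.Out w.1)

/-- The input wires of the process box: `none` is the wire from the global past, the others are
the output wires of the agents. The global past always sends exactly one message. -/
def BoxInBasis (L : Positions A T) : Option L.OutWire → Type u
  | none => A.Past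
  | some w => Option (A.Out w.1)

/-- The output wires of the process box: `none` is the wire to the global future, the others are
the input wires of the agents. -/
def BoxOutBasis (L : Positions A T) : Option L.InWire → Type u
  | none => A.Future
  | some w => Option (A.Inp w.1)

instance (L : Positions A T) : ∀ w, Fintype (L.BoxInBasis w)
  | none => inferInstanceAs (Fintype A.Past)
  | some w => inferInstanceAs (Fintype (Option (A.Out w.1)))

instance (L : Positions A T) : ∀ w, DecidableEq (L.BoxInBasis w)
  | none => inferInstanceAs (DecidableEq A.Past)
  | some w => inferInstanceAs (DecidableEq (Option (A.Out w.1)))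

instance (L : Positions A T) : ∀ w, Fintype (L.BoxOutBasis w)
  | none => inferInstanceAs (Fintype A.Future)
  | some w => inferInstanceAs (Fintype (Option (A.Inp w.1)))

instance (L : Positions A T) : ∀ w, DecidableEq (L.BoxOutBasis w)
  | none => inferInstanceAs (DecidableEq A.Future)
  | some w => inferInstanceAs (DecidableEq (Option (A.Inp w.1)))

/-- Basis of the total input space of the process box. -/
abbrev BoxIn (L : Positions A T) : Type (max u v) := ∀ w, L.BoxInBasis w

/-- Basis of the total output space of the process box. -/
abbrev BoxOut (L : Positions A T) : Type (max u v) := ∀ w, L.BoxOutBasis w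

/-- The basis state of the box input made of a state of the global past and one of the agents'
output wires. -/
def boxIn (L : Positions A T) (p : A.Past) (b : L.AgentOut) : L.BoxIn
  | none => p
  | some w => b w

/-- The basis state of the box output made of a state of the agents' input wires and one of the
global future. -/
def boxOut (L : Positions A T) (a : L.AgentIn) (f : A.Future) : L.BoxOut
  | none => f
  | some w => a w

/-- The input wires of the process box with position in `C`. -/
def boxInWires (L : Positions A T) (C : LowerSet T) : Set (Option L.OutWire) :=
  {w | w.elim L.past (fun w => (w.2 : T)) ∈ C}

/-- The output wires of the process box with position in `C`. -/
def boxOutWires (L : Positions A T) (C : LowerSet T) : Set (Option L.InWire) :=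
  {w | w.elim L.future (fun w => (w.2 : T)) ∈ C}

end Positions

/-! ### Local operations -/

/-- A local operation (for one fixed measurement outcome) of the agent `i`. By the operation-space
restriction it is a tensor product over the input positions `t` of maps from the input wire at `t`
to the output wire at `𝒪_i(t)`. Local order: the vacuum is mapped to the vacuum. Active agents: a
message is mapped to a message. -/
structure LocalOperation {A : AgentSpaces.{u}} {T : Type v} [PartialOrder T]
    (L : Positions A T) (i : A.Agent) where
  op : {t // t ∈ L.inp i} → (Matrix (Option (A.Inp i)) (Option (A.Inp i)) ℂ →ₗ[ℂ]
    Matrix (Option (A.Out i)) (Option (A.Out i)) ℂ)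
  completelyPositive : ∀ t, IsCompletelyPositive (op t)
  traceNonincreasing : ∀ t, IsTraceNonincreasing (op t)
  localOrder : ∀ t, op t (Matrix.single none none 1) = Matrix.single none none 1
  active : ∀ t a a' y, op t (Matrix.single (some a) (some a') 1) none y = 0 ∧
    op t (Matrix.single (some a) (some a') 1) y none = 0

namespace Positions

variable {A : AgentSpaces.{u}} {T : Type v} [PartialOrder T] [DecidableEq T]

/-- The Choi matrix `⊗_i M_{A_i}` of the product `⊗_i ⊗_t M_{A_i}^t` of the local operations. -/
def agentsChoi (L : Positions A T) (M : ∀ i, LocalOperation L i) :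
    Matrix (L.AgentIn × L.AgentOut) (L.AgentIn × L.AgentOut) ℂ :=
  Matrix.of fun u v => ∏ w : L.InWire,
    choi ((M w.1).op w.2) (u.1 w, u.2 (L.answer w)) (v.1 w, v.2 (L.answer w))

/-- The Choi matrix of a map from the box input to the box output, regarded as an operator on the
wires of the agents (the spaces shared with the agents) and on the global past and future. -/
def boxChoi (L : Positions A T)
    (Φ : Matrix L.BoxIn L.BoxIn ℂ →ₗ[ℂ] Matrix L.BoxOut L.BoxOut ℂ) :
    Matrix ((L.AgentIn × L.AgentOut) × (A.Past × A.Future))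
      ((L.AgentIn × L.AgentOut) × (A.Past × A.Future)) ℂ :=
  Matrix.of fun u v => choi Φ (L.boxIn u.2.1 u.1.2, L.boxOut u.1.1 u.2.2)
    (L.boxIn v.2.1 v.1.2, L.boxOut v.1.1 v.2.2)

/-- `⊗_i M_{A_i} * Φ`: the Choi matrix of the map from the global past to the global future
obtained by composing the box with the local operations. -/
def compose (L : Positions A T)
    (Φ : Matrix L.BoxIn L.BoxIn ℂ →ₗ[ℂ] Matrix L.BoxOut L.BoxOut ℂ)
    (M : ∀ i, LocalOperation L i) : Matrix (A.Past × A.Future) (A.Past × A.Future) ℂ :=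
  linkProduct (L.agentsChoi M) (L.boxChoi Φ)

/-- The state `y` of the agents' wires has messages exactly on the input wires in `s` and on the
output wires in `r`. -/
def HasPattern (L : Positions A T) (s : L.InWire → Bool) (r : L.OutWire → Bool)
    (y : L.AgentIn × L.AgentOut) : Prop :=
  (∀ w, (y.1 w).isSome = s w) ∧ (∀ w, (y.2 w).isSome = r w)

instance (L : Positions A T) (s : L.InWire → Bool) (r : L.OutWire → Bool)
    (y : L.AgentIn × L.AgentOut) : Decidable (L.HasPattern s r y) :=
  inferInstanceAs (Decidable (_ ∧ _))

/-- The branch of the composition `⊗_i M_{A_i} * Φ` in which messages are found exactly on the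
input wires in `s` and the output wires in `r` of the agents: the operations of the agents are
preceded and followed by the projectors onto this message pattern. -/
def composeBranch (L : Positions A T)
    (Φ : Matrix L.BoxIn L.BoxIn ℂ →ₗ[ℂ] Matrix L.BoxOut L.BoxOut ℂ)
    (M : ∀ i, LocalOperation L i) (s : L.InWire → Bool) (r : L.OutWire → Bool) :
    Matrix (A.Past × A.Future) (A.Past × A.Future) ℂ :=
  linkProduct
    (Matrix.of fun y y' => if L.HasPattern s r y ∧ L.HasPattern s r y' then
      L.agentsChoi M y y' else 0)
    (L.boxChoi Φ)

end Positions

/-! ### Process boxes -/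

/-- A process box with set of positions `T`. As `T` has a greatest element, it is a bounded cut
of itself, and the consistent family `Φ^C` of maps of a causal box is given by the total map
`Φ = Φ^T` through `Φ^C = Tr_{T \ C} ∘ Φ`.

* `causal`: the output at the positions in the cut `C` is determined by the input at the positions
  in `χ C`, for some causality function `χ`.
* `exactlyOne`: the box can be composed with all agents that obey the wire-space restriction (each
  agent receives at most one message in the whole run), and agents are fully active (each receives
  a message with probability one): every branch in which the number of messages received by some
  agent is not one vanishes, whatever the local operations are. -/
structure ProcessBox (A : AgentSpaces.{u}) (T : Type v) [PartialOrder T] [Fintype T]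
    [DecidableEq T] where
  pos : Positions A T
  map : Matrix pos.BoxIn pos.BoxIn ℂ →ₗ[ℂ] Matrix pos.BoxOut pos.BoxOut ℂ
  completelyPositive : IsCompletelyPositive map
  tracePreserving : IsTracePreserving map
  causal : ∃ χ : LowerSet T → LowerSet T, IsCausalityFunction χ ∧
    ∀ (C : LowerSet T) (ρ ρ' : Matrix pos.BoxIn pos.BoxIn ℂ),
      partialTrace (pos.boxInWires (χ C)) ρ = partialTrace (pos.boxInWires (χ C)) ρ' →
      partialTrace (pos.boxOutWires C) (map ρ) = partialTrace (pos.boxOutWires C) (map ρ')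
  exactlyOne : ∀ (M : ∀ i, LocalOperation pos i) (s : pos.InWire → Bool)
    (r : pos.OutWire → Bool),
    (∃ i, (Finset.univ.filter fun t : {t // t ∈ pos.inp i} => s ⟨i, t⟩ = true).card ≠ 1) →
    pos.composeBranch map M s r = 0

namespace ProcessBox

variable {A : AgentSpaces.{u}} {T : Type v} [PartialOrder T] [Fintype T] [DecidableEq T]

/-- `⊗_i M_{A_i} * Φ`. -/
def compose (Φ : ProcessBox A T) (M : ∀ i, LocalOperation Φ.pos i) :
    Matrix (A.Past × A.Future) (A.Past × A.Future) ℂ :=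
  Φ.pos.compose Φ.map M

/-- Whatever the box receives, it sends at most one message at each position; the message to the
global future is counted. -/
def SendsAtMostOne (Φ : ProcessBox A T) : Prop :=
  ∀ (ρ : Matrix Φ.pos.BoxIn Φ.pos.BoxIn ℂ) (a : Φ.pos.AgentIn) (f : A.Future) (t : T),
    1 < (Finset.univ.filter fun w : Φ.pos.InWire => (w.2 : T) = t ∧ (a w).isSome = true).card
      + (if t = Φ.pos.future then 1 else 0) →
    Φ.map ρ (Φ.pos.boxOut a f) (Φ.pos.boxOut a f) = 0

/-- In composition with any local operations, the box receives at most one message at each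
position; the message from the global past is counted. -/
def ReceivesAtMostOne (Φ : ProcessBox A T) : Prop :=
  ∀ (M : ∀ i, LocalOperation Φ.pos i) (s : Φ.pos.InWire → Bool) (r : Φ.pos.OutWire → Bool) (t : T),
    1 < (Finset.univ.filter fun w : Φ.pos.OutWire => (w.2 : T) = t ∧ r w = true).card
      + (if t = Φ.pos.past then 1 else 0) →
    Φ.pos.composeBranch Φ.map M s r = 0

/-- Operational equivalence: a one-to-one correspondence of the agents and maps from the local
operations of the agents of `Φ` to those of the corresponding agents of `Φ'` such that the
compositions with corresponding local operations agree, up to unitaries between the global pasts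
and between the global futures. -/
def OperationallyEquivalent {A' : AgentSpaces.{u}} {T' : Type v} [PartialOrder T'] [Fintype T']
    [DecidableEq T'] (Φ : ProcessBox A T) (Φ' : ProcessBox A' T') : Prop :=
  ∃ (e : A'.Agent ≃ A.Agent)
    (f : ∀ j : A'.Agent, LocalOperation Φ.pos (e j) → LocalOperation Φ'.pos j)
    (U : Matrix A'.Past A.Past ℂ) (V : Matrix A'.Future A.Future ℂ),
    (Uᴴ * U = 1 ∧ U * Uᴴ = 1) ∧ (Vᴴ * V = 1 ∧ V * Vᴴ = 1) ∧
    ∀ M : (∀ i, LocalOperation Φ.pos i),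
      Φ'.compose (fun j => f j (M (e j))) = (U ⊗ₖ V) * Φ.compose M * (U ⊗ₖ V)ᴴ

end ProcessBox

/-- The set of positions `{1, …, m}`. -/
abbrev Steps (m : ℕ) : Type := {t : ℕ // t ∈ Finset.Icc 1 m}

/-- The simplified form of the positions: `𝒯 = {1, …, m}`, all agents have the input positions
`{2, 4, …}`, the output positions `{3, 5, …}` and `𝒪(t) = t + 1`; the global past (the agent with
trivial input) sends at `1` and the global future (which has no output) receives at the last input
position `m`, which is reserved for it. -/
def ProcessBox.HasSimpleForm {A : AgentSpaces.{u}} {m : ℕ} (Φ : ProcessBox A (Steps m)) : Prop :=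
  Even m ∧ (Φ.pos.past : ℕ) = 1 ∧ (Φ.pos.future : ℕ) = m ∧
  ∀ i, (∀ t : Steps m, t ∈ Φ.pos.inp i ↔ Even (t : ℕ) ∧ (t : ℕ) < m) ∧
    (∀ t : Steps m, t ∈ Φ.pos.out i ↔ Odd (t : ℕ) ∧ 1 < (t : ℕ)) ∧
    ∀ t, ((Φ.pos.resp i t : Steps m) : ℕ) = (t : Steps m) + 1

end

/-! Only the schedule changes. Let m = 2n + 2 and number the N agents 0, …, N - 1. The pair of
positions (2 + 2b, 3 + 2b), in which the box may address all agents at once, is replaced by a block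
of N consecutive pairs, and agent p is served in pair bN + p. On all other wires the new box sends
the vacuum and discards what comes back. Each position then has at most one wire in use. This bounds
the messages sent for every input, and the messages received because agents answer the vacuum by the
vacuum.

An agent acts on a new slot as on the old slot of its block. Vacuum maps to vacuum with weight one,
so unused slots contribute a factor 1, and composition with the new box equals composition with the
old one, branch by branch (`compose_extendMap`, `composeBranch_extendMap`). This gives the
equivalence, with identity unitaries, and transfers the exactly-one condition.

Causality needs care, since the old `χ` is arbitrary (`causal_extendMap`). On a chain, a proper
lower subset of `C` lies strictly below some point of `C`. The new schedule keeps every relation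
"received before sent" of the old one, so strict precedence serves as the new causality function. -/

set_option linter.unusedSectionVars false

/-! ### Push-forwards of operators along maps of basis states -/

section PushTrace

variable {U X Y : Type*} [Fintype U]

open Classical in
/-- The operator with entries `∑ ρ u v`, over the `u ∈ π⁻¹ x` and `v ∈ π⁻¹ y` with `R u v`. If `R`
says that `u` and `v` agree on the wires that `π` forgets, then this is a partial trace. -/
noncomputable def pushTrace (π : U → X) (R : U → U → Prop) :
    Matrix U U ℂ →ₗ[ℂ] Matrix X X ℂ where
  toFun ρ := Matrix.of fun x y => ∑ u, ∑ v, if π u = x ∧ π v = y ∧ R u v then ρ u v else 0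
  map_add' ρ σ := by
    ext x y
    simp only [Matrix.of_apply, Matrix.add_apply, ← Finset.sum_add_distrib]
    refine Finset.sum_congr rfl fun u _ => Finset.sum_congr rfl fun v _ => ?_
    split_ifs <;> simp
  map_smul' c ρ := by
    ext x y
    simp only [Matrix.of_apply, Matrix.smul_apply, Finset.smul_sum, RingHom.id_apply]
    refine Finset.sum_congr rfl fun u _ => Finset.sum_congr rfl fun v _ => ?_
    split_ifs <;> simp

open Classical in
theorem pushTrace_apply (π : U → X) (R : U → U → Prop) (ρ : Matrix U U ℂ) (x y : X) :
    pushTrace π R ρ x y = ∑ u, ∑ v, if π u = x ∧ π v = y ∧ R u v then ρ u v else 0 := rfl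

/-- Summing a push-forward against a kernel. -/
theorem sum_mul_pushTrace [Fintype X] (π : U → X) (R : U → U → Prop) (ρ : Matrix U U ℂ) (g : X → X → ℂ) :
    ∑ x, ∑ y, g x y * pushTrace π R ρ x y =
      ∑ u, ∑ v, g (π u) (π v) * (open Classical in if R u v then ρ u v else 0) := by
  classical
  simp only [pushTrace_apply, Finset.mul_sum]
  have h1 : ∀ x : X, ∑ y, ∑ u, ∑ v, g x y * (if π u = x ∧ π v = y ∧ R u v then ρ u v else 0) =
      ∑ u, ∑ v, if π u = x then g x (π v) * (if R u v then ρ u v else 0) else 0 := by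
    intro x
    rw [Finset.sum_comm]
    refine Finset.sum_congr rfl fun u _ => ?_
    rw [Finset.sum_comm]
    refine Finset.sum_congr rfl fun v _ => ?_
    rw [Finset.sum_eq_single (π v)]
    · by_cases h : π u = x <;> simp [h]
    · intro y _ hy
      simp [Ne.symm hy]
    · simp
  simp only [h1]
  rw [Finset.sum_comm]
  refine Finset.sum_congr rfl fun u _ => ?_
  rw [Finset.sum_comm]
  refine Finset.sum_congr rfl fun v _ => ?_
  simp

/-- Brings a partial trace taken after discarding or adding wires into the form to which
`pushTrace_congr` applies. -/
theorem pushTrace_pushTrace [Fintype X] (π : U → X) (R : U → U → Prop) (π' : X → Y) (R' : X → X → Prop)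
    (ρ : Matrix U U ℂ) :
    pushTrace π' R' (pushTrace π R ρ) =
      pushTrace (π' ∘ π) (fun u v => R u v ∧ R' (π u) (π v)) ρ := by
  classical
  ext x y
  rw [pushTrace_apply, pushTrace_apply]
  have := sum_mul_pushTrace π R ρ (fun p q => if π' p = x ∧ π' q = y ∧ R' p q then 1 else 0)
  simp only [ite_mul, one_mul, zero_mul] at this
  rw [this]
  refine Finset.sum_congr rfl fun u _ => Finset.sum_congr rfl fun v _ => ?_
  simp only [Function.comp_apply, ← ite_and]
  congr 1
  simp only [eq_iff_iff]
  tauto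

/-- If `π'` forgets more than `π`, then the push-forward along `π'` is determined by that
along `π`. -/
theorem pushTrace_congr [Fintype X] {π : U → X} {R : U → U → Prop} {π' : U → Y} {R' : U → U → Prop}
    (hπ : ∀ u v, π u = π v → π' u = π' v) (hR : ∀ u v, R' u v → R u v)
    (hR' : ∀ u v u' v', R u v → π u' = π u → π v' = π v → R' u' v' → R' u v)
    {ρ σ : Matrix U U ℂ} (h : pushTrace π R ρ = pushTrace π R σ) :
    pushTrace π' R' ρ = pushTrace π' R' σ := by
  classical
  -- Each entry of the coarser push-forward is a sum of entries of the finer one with 0/1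
  -- coefficients. By `hR'`, a single `R'`-related pair above `(p, q)` makes all `R`-related pairs
  -- above it `R'`-related.
  have key : ∀ (τ : Matrix U U ℂ) (x y : Y), pushTrace π' R' τ x y =
      ∑ p, ∑ q, (if ∃ u v, π u = p ∧ π v = q ∧ π' u = x ∧ π' v = y ∧ R' u v then 1 else 0) *
        pushTrace π R τ p q := by
    intro τ x y
    rw [sum_mul_pushTrace, pushTrace_apply]
    refine Finset.sum_congr rfl fun u _ => Finset.sum_congr rfl fun v _ => ?_
    rw [ite_mul, one_mul, zero_mul, ← ite_and]
    congr 1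
    rw [eq_iff_iff]
    constructor
    · rintro ⟨hx, hy, hr⟩
      exact ⟨⟨u, v, rfl, rfl, hx, hy, hr⟩, hR _ _ hr⟩
    · rintro ⟨⟨u', v', hu, hv, hx, hy, hr⟩, hr'⟩
      exact ⟨(hπ _ _ hu).symm.trans hx, (hπ _ _ hv).symm.trans hy, hR' _ _ _ _ hr' hu hv hr⟩
  ext x y
  rw [key, key, h]

theorem pushTrace_single [DecidableEq U] [DecidableEq X] (π : U → X) (R : U → U → Prop)
    (u v : U) :
    pushTrace π R (Matrix.single u v 1) =
      (open Classical in if R u v then Matrix.single (π u) (π v) 1 else 0) := by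
  classical
  ext x y
  rw [pushTrace_apply, Finset.sum_eq_single u, Finset.sum_eq_single v]
  · by_cases hR : R u v <;> simp [hR, Matrix.single_apply]
  · intro w _ hw
    simp [Ne.symm hw]
  · simp
  · intro w _ hw
    simp [Ne.symm hw]
  · simp

/-- Kraus form: for each value `z` of `κ`, conjugate by the 0/1 matrix of `π` restricted to the
fibre over `z`, then sum over `z`. -/
theorem posSemidef_pushTrace [Fintype X] {Z : Type*} [Fintype Z] (π : U → X) (κ : U → Z)
    {ρ : Matrix U U ℂ} (hρ : ρ.PosSemidef) :
    (pushTrace π (fun u v => κ u = κ v) ρ).PosSemidef := by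
  classical
  have : pushTrace π (fun u v => κ u = κ v) ρ = ∑ z : Z,
      (Matrix.of fun (x : X) u => if π u = x ∧ κ u = z then (1 : ℂ) else 0) * ρ *
        (Matrix.of fun (x : X) u => if π u = x ∧ κ u = z then (1 : ℂ) else 0)ᴴ := by
    ext x y
    simp only [pushTrace_apply, Matrix.sum_apply, Matrix.mul_apply, Matrix.conjTranspose_apply,
      Matrix.of_apply, Finset.sum_mul]
    rw [Finset.sum_comm]
    simp only [Finset.sum_comm (s := (Finset.univ : Finset Z))]
    refine Finset.sum_congr rfl fun v _ => Finset.sum_congr rfl fun u _ => ?_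
    rw [Finset.sum_eq_single (κ u)]
    · rw [eq_comm (a := κ u) (b := κ v)]
      by_cases h1 : π u = x <;> by_cases h2 : π v = y <;> by_cases h3 : κ v = κ u <;>
        simp [h1, h2, h3]
    · intro z _ hz
      simp [Ne.symm hz]
    · simp
  rw [this]
  exact Matrix.posSemidef_sum _ fun z _ => hρ.mul_mul_conjTranspose_same _

theorem isCompletelyPositive_pushTrace [Fintype X] {Z : Type*} [Fintype Z] (π : U → X) (κ : U → Z) :
    IsCompletelyPositive (pushTrace π (fun u v => κ u = κ v)) := by
  classical
  intro k ρ hρ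
  have : amplify (pushTrace π (fun u v => κ u = κ v)) k ρ =
      pushTrace (Prod.map id π) (fun u v : Fin k × U => κ u.2 = κ v.2) ρ := by
    ext ⟨a, x⟩ ⟨b, y⟩
    simp only [amplify, Matrix.of_apply, pushTrace_apply, Fintype.sum_prod_type, Prod.map,
      Prod.mk.injEq, id]
    rw [Finset.sum_eq_single a]
    · refine Finset.sum_congr rfl fun u _ => ?_
      rw [Finset.sum_eq_single b]
      · simp
      · intro c _ hc
        simp [hc]
      · simp
    · intro c _ hc
      simp [hc]
    · simp
  rw [this]
  exact posSemidef_pushTrace (Prod.map id π) (fun u : Fin k × U => κ u.2) hρ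

/-- By the hypothesis, exactly the diagonal entries of `ρ` reach the diagonal. -/
theorem isTracePreserving_pushTrace [Fintype X] {π : U → X} {R : U → U → Prop}
    (h : ∀ u v, π u = π v ∧ R u v ↔ u = v) : IsTracePreserving (pushTrace π R) := by
  classical
  intro ρ
  have := sum_mul_pushTrace π R ρ (fun p q => if p = q then 1 else 0)
  simp only [ite_mul, one_mul, zero_mul, Finset.sum_ite_eq, Finset.mem_univ, if_true, ← ite_and,
    h] at this
  simpa [Matrix.trace] using this

theorem IsCompletelyPositive.comp {X Y Z : Type*} {Φ : Matrix Y Y ℂ →ₗ[ℂ] Matrix Z Z ℂ}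
    {Ψ : Matrix X X ℂ →ₗ[ℂ] Matrix Y Y ℂ} (hΦ : IsCompletelyPositive Φ)
    (hΨ : IsCompletelyPositive Ψ) : IsCompletelyPositive (Φ ∘ₗ Ψ) :=
  fun k ρ hρ => hΦ k _ (hΨ k ρ hρ)

end PushTrace

/-- With this, causality becomes bookkeeping about which basis states agree on which wires. -/
theorem partialTrace_eq_pushTrace {W : Type*} [Fintype W] [DecidableEq W] {B : W → Type*}
    [∀ w, Fintype (B w)] (K : Set W) (ρ : Matrix (∀ w, B w) (∀ w, B w) ℂ) :
    partialTrace K ρ = pushTrace (fun u (w : {w // w ∈ K}) => u w)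
      (fun u v => ∀ w ∉ K, u w = v w) ρ := by
  classical
  ext x y
  set e := Equiv.piEquivPiSubtypeProd (· ∈ K) B with he
  have h1 : ∀ a z, (fun w : {w // w ∈ K} => e.symm (a, z) w) = a := by
    intro a z
    exact congrArg Prod.fst (e.apply_symm_apply (a, z))
  have h2 : ∀ a z, (fun w : {w // w ∉ K} => e.symm (a, z) w) = z := by
    intro a z
    exact congrArg Prod.snd (e.apply_symm_apply (a, z))
  have h3 : ∀ a z b z', (∀ w ∉ K, e.symm (a, z) w = e.symm (b, z') w) ↔ z = z' := by
    intro a z b z'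
    rw [← h2 a z, ← h2 b z', funext_iff]
    simp [h2]
  rw [pushTrace_apply, ← e.symm.sum_comp, Fintype.sum_prod_type, Finset.sum_eq_single x]
  · simp only [partialTrace, Matrix.of_apply]
    refine Finset.sum_congr (by congr!) fun z _ => ?_
    rw [← e.symm.sum_comp, Fintype.sum_prod_type, Finset.sum_eq_single y]
    · simp only [h1, h3, true_and]
      rw [Finset.sum_ite_eq]
      simp [he]
    · intro b _ hb
      simp [h1, hb]
    · simp
  · intro b _ hb
    simp [h1, hb]
  · simp

/-! ### Adding wires that carry the vacuum -/

/-- For each agent a set `P i` of slots is embedded in a larger set `Q i` of slots. -/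
structure SlotEmbedding {I : Type*} (P Q : I → Type*) where
  emb : ∀ i, P i → Q i
  ret : ∀ i, Q i → P i
  ret_emb : ∀ i p, ret i (emb i p) = p

namespace SlotEmbedding

variable {I : Type*} {P Q : I → Type*} (J : SlotEmbedding P Q) {B : I → Type*}

def toWire (w : Σ i, P i) : Σ i, Q i := ⟨w.1, J.emb w.1 w.2⟩

def IsUsed (w : Σ i, Q i) : Prop := J.emb w.1 (J.ret w.1 w.2) = w.2

theorem isUsed_toWire (w : Σ i, P i) : J.IsUsed (J.toWire w) := by
  simp [IsUsed, toWire, J.ret_emb]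

theorem toWire_injective : Function.Injective J.toWire := by
  rintro ⟨i, p⟩ ⟨k, q⟩ h
  simp only [toWire, Sigma.mk.injEq] at h
  obtain ⟨rfl, h⟩ := h
  rw [← J.ret_emb i p, eq_of_heq h, J.ret_emb]

theorem isUsed_iff {w : Σ i, Q i} : J.IsUsed w ↔ ∃ w₀, J.toWire w₀ = w := by
  constructor
  · intro h
    exact ⟨⟨w.1, J.ret w.1 w.2⟩, Sigma.ext rfl (heq_of_eq h)⟩
  · rintro ⟨w₀, rfl⟩
    exact J.isUsed_toWire w₀

/-- Forget the state of the unused wires. -/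
def restrict (y : ∀ w : Σ i, Q i, Option (B w.1)) (w : Σ i, P i) : Option (B w.1) :=
  y (J.toWire w)

open Classical in
/-- Put the vacuum on the unused wires. -/
noncomputable def extend (x : ∀ w : Σ i, P i, Option (B w.1)) (w : Σ i, Q i) : Option (B w.1) :=
  if J.IsUsed w then x ⟨w.1, J.ret w.1 w.2⟩ else none

theorem extend_of_not_isUsed (x : ∀ w : Σ i, P i, Option (B w.1)) {w : Σ i, Q i}
    (h : ¬ J.IsUsed w) : J.extend x w = none := if_neg h

theorem extend_toWire (x : ∀ w : Σ i, P i, Option (B w.1)) (w : Σ i, P i) :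
    J.extend x (J.toWire w) = x w := by
  rw [extend, if_pos (J.isUsed_toWire w)]
  -- The type of the value depends only on the agent, so the slot is changed with the agent held
  -- fixed.
  have h : ∀ (i : I) (p q : P i), p = q → (x ⟨i, p⟩ : Option (B i)) = x ⟨i, q⟩ := by
    rintro i p _ rfl
    rfl
  exact h _ _ _ (J.ret_emb w.1 w.2)

theorem restrict_extend (x : ∀ w : Σ i, P i, Option (B w.1)) : J.restrict (J.extend x) = x :=
  funext fun w => J.extend_toWire x w

theorem extend_restrict {y : ∀ w : Σ i, Q i, Option (B w.1)}
    (h : ∀ w, ¬ J.IsUsed w → y w = none) : J.extend (J.restrict y) = y := by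
  funext w
  by_cases hw : J.IsUsed w
  · obtain ⟨w₀, rfl⟩ := J.isUsed_iff.1 hw
    rw [extend_toWire, restrict]
  · rw [extend_of_not_isUsed _ _ hw, h w hw]

theorem extend_injective : Function.Injective (J.extend (B := B)) :=
  Function.LeftInverse.injective J.restrict_extend

end SlotEmbedding

/-! ### The box that ignores additional wires -/

namespace Positions

variable {A : AgentSpaces.{u}} {T T' : Type v} [PartialOrder T] [PartialOrder T'] [DecidableEq T]
  [DecidableEq T']

/-- An embedding of the input positions induces one of the output positions. -/
def outEmbedding {L : Positions A T} {L' : Positions A T'}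
    (J : SlotEmbedding (fun i => {t // t ∈ L.inp i}) (fun i => {t // t ∈ L'.inp i})) :
    SlotEmbedding (fun i => {t // t ∈ L.out i}) (fun i => {t // t ∈ L'.out i}) where
  emb i t := L'.resp i (J.emb i ((L.resp i).symm t))
  ret i t := L.resp i (J.ret i ((L'.resp i).symm t))
  ret_emb i t := by simp [J.ret_emb]

section

variable {L : Positions A T} {L' : Positions A T'}
  (J : SlotEmbedding (fun i => {t // t ∈ L.inp i}) (fun i => {t // t ∈ L'.inp i}))

theorem answer_bijective (L : Positions A T) : Function.Bijective L.answer := by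
  constructor
  · rintro ⟨i, s⟩ ⟨k, t⟩ h
    simp only [answer, Sigma.mk.injEq] at h
    obtain ⟨rfl, h⟩ := h
    rw [(L.resp i).injective (eq_of_heq h)]
  · rintro ⟨i, t⟩
    exact ⟨⟨i, (L.resp i).symm t⟩, by simp [answer]⟩

theorem toWire_answer (w : L.InWire) :
    (outEmbedding J).toWire (L.answer w) = L'.answer (J.toWire w) := by
  simp only [SlotEmbedding.toWire, answer, outEmbedding, Equiv.symm_apply_apply]
  rfl

theorem isUsed_answer (w : L'.InWire) : (outEmbedding J).IsUsed (L'.answer w) ↔ J.IsUsed w := by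
  simp [SlotEmbedding.IsUsed, answer, outEmbedding]

/-- Restriction of the basis states of the larger box input. -/
def restrictIn (y : L'.BoxIn) : L.BoxIn :=
  L.boxIn (y none) ((outEmbedding J).restrict fun w => y (some w))

/-- Extension of the basis states of the smaller box output by the vacuum. -/
noncomputable def extendOut (x : L.BoxOut) : L'.BoxOut :=
  L'.boxOut (J.extend fun w => x (some w)) (x none)

/-- Agreement of basis states of the larger box input on all wires that the smaller box lacks. -/
def UnusedEq (y z : L'.BoxIn) : Prop :=
  ∀ w : L'.OutWire, ¬ (outEmbedding J).IsUsed w → y (some w) = z (some w)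

theorem boxIn_injective (L : Positions A T) {p q : A.Past} {b c : L.AgentOut}
    (h : L.boxIn p b = L.boxIn q c) : p = q ∧ b = c :=
  ⟨congrFun h none, funext fun w => congrFun h (some w)⟩

theorem boxOut_injective (L : Positions A T) {p q : A.Future} {b c : L.AgentIn}
    (h : L.boxOut b p = L.boxOut c q) : b = c ∧ p = q :=
  ⟨funext fun w => congrFun h (some w), congrFun h none⟩

theorem boxOut_eta (L : Positions A T) (x : L.BoxOut) :
    L.boxOut (fun w => x (some w)) (x none) = x := by
  funext w
  cases w <;> rfl

theorem restrictIn_boxIn (p : A.Past) (b : L'.AgentOut) :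
    restrictIn J (L'.boxIn p b) = L.boxIn p ((outEmbedding J).restrict b) := rfl

theorem extendOut_boxOut (a : L.AgentIn) (f : A.Future) :
    extendOut J (L.boxOut a f) = L'.boxOut (J.extend a) f := rfl

theorem extendOut_injective : Function.Injective (extendOut J) := by
  intro x y h
  obtain ⟨h1, h2⟩ := L'.boxOut_injective h
  rw [← L.boxOut_eta x, ← L.boxOut_eta y, h2, J.extend_injective h1]

theorem restrictIn_unusedEq_iff (y z : L'.BoxIn) :
    restrictIn J y = restrictIn J z ∧ UnusedEq J y z ↔ y = z := by
  constructor
  · rintro ⟨h, h'⟩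
    obtain ⟨h1, h2⟩ := L.boxIn_injective h
    funext w
    cases w with
    | none => exact h1
    | some w =>
      by_cases hw : (outEmbedding J).IsUsed w
      · obtain ⟨w₀, rfl⟩ := (outEmbedding J).isUsed_iff.1 hw
        exact congrFun h2 w₀
      · exact h' w hw
  · rintro rfl
    exact ⟨rfl, fun _ _ => rfl⟩

/-- Discard the additional wires to the box. -/
noncomputable def discard : Matrix L'.BoxIn L'.BoxIn ℂ →ₗ[ℂ] Matrix L.BoxIn L.BoxIn ℂ :=
  pushTrace (restrictIn J) (UnusedEq J)

/-- Send the vacuum on the additional wires from the box. -/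
noncomputable def addVacuum : Matrix L.BoxOut L.BoxOut ℂ →ₗ[ℂ] Matrix L'.BoxOut L'.BoxOut ℂ :=
  pushTrace (extendOut J) fun _ _ => True

/-- The box on the larger set of wires that ignores the additional ones. -/
noncomputable def extendMap (Φ : Matrix L.BoxIn L.BoxIn ℂ →ₗ[ℂ] Matrix L.BoxOut L.BoxOut ℂ) :
    Matrix L'.BoxIn L'.BoxIn ℂ →ₗ[ℂ] Matrix L'.BoxOut L'.BoxOut ℂ :=
  addVacuum J ∘ₗ Φ ∘ₗ discard J

end

end Positions

/-! ### Composition of the extended box with agents -/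

namespace Positions

variable {A : AgentSpaces.{u}} {T T' : Type v} [PartialOrder T] [PartialOrder T'] [DecidableEq T]
  [DecidableEq T'] {L : Positions A T} {L' : Positions A T'}
  (J : SlotEmbedding (fun i => {t // t ∈ L.inp i}) (fun i => {t // t ∈ L'.inp i}))
  (Φ : Matrix L.BoxIn L.BoxIn ℂ →ₗ[ℂ] Matrix L.BoxOut L.BoxOut ℂ)

theorem isCompletelyPositive_extendMap (hΦ : IsCompletelyPositive Φ) :
    IsCompletelyPositive (extendMap J Φ) := by
  classical
  refine IsCompletelyPositive.comp ?_ (hΦ.comp ?_)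
  · have := isCompletelyPositive_pushTrace (extendOut J) (fun _ => ())
    simpa [addVacuum] using this
  · have := isCompletelyPositive_pushTrace (restrictIn J) (fun (y : L'.BoxIn)
      (w : {w // ¬ (outEmbedding J).IsUsed w}) => (y (some w) : Option (A.Out w.1.1)))
    convert this using 1
    rw [discard]
    congr 1
    funext y z
    simp only [UnusedEq, funext_iff, Subtype.forall]

theorem isTracePreserving_extendMap (hΦ : IsTracePreserving Φ) :
    IsTracePreserving (extendMap J Φ) := by
  intro ρ
  have h1 := isTracePreserving_pushTrace (restrictIn_unusedEq_iff J) ρ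
  have h2 := isTracePreserving_pushTrace (π := extendOut J) (R := fun _ _ => True)
    (fun u v => by rw [and_true, (extendOut_injective J).eq_iff]) (Φ (discard J ρ))
  exact h2.trans ((hΦ _).trans h1)

theorem addVacuum_extendOut (σ : Matrix L.BoxOut L.BoxOut ℂ) (x y : L.BoxOut) :
    addVacuum J σ (extendOut J x) (extendOut J y) = σ x y := by
  classical
  rw [addVacuum, pushTrace_apply, Finset.sum_eq_single x, Finset.sum_eq_single y]
  · simp
  · intro w _ hw
    simp [(extendOut_injective J).eq_iff, hw]
  · simp
  · intro w _ hw
    simp [(extendOut_injective J).eq_iff, hw]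
  · simp

/-- Nothing is assumed of `σ`; hence the bound on sent messages will hold for any input of the box.
-/
theorem addVacuum_ne_zero {σ : Matrix L.BoxOut L.BoxOut ℂ} {a c : L'.AgentIn} {f g : A.Future}
    (h : addVacuum J σ (L'.boxOut a f) (L'.boxOut c g) ≠ 0) :
    (∃ a₀, J.extend a₀ = a) ∧ ∃ c₀, J.extend c₀ = c := by
  classical
  rw [addVacuum, pushTrace_apply] at h
  obtain ⟨x, -, hx⟩ := Finset.exists_ne_zero_of_sum_ne_zero h
  obtain ⟨y, -, hy⟩ := Finset.exists_ne_zero_of_sum_ne_zero hx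
  have hxy : extendOut J x = L'.boxOut a f ∧ extendOut J y = L'.boxOut c g ∧ True := by
    by_contra hn
    exact hy (if_neg hn)
  exact ⟨⟨_, (L'.boxOut_injective hxy.1).1⟩, ⟨_, (L'.boxOut_injective hxy.2.1).1⟩⟩

theorem boxChoi_extendMap_ne_zero {a c : L'.AgentIn} {b d : L'.AgentOut} {z z' : A.Past × A.Future}
    (h : L'.boxChoi (extendMap J Φ) ((a, b), z) ((c, d), z') ≠ 0) :
    (∃ a₀, J.extend a₀ = a) ∧ ∃ c₀, J.extend c₀ = c :=
  addVacuum_ne_zero J h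

/-- Both input states have the vacuum on the unused wires, so discarding these wires takes the
matrix unit to the matrix unit of the restricted states. -/
theorem boxChoi_extendMap_extend (a c : L.AgentIn) (b d : L.AgentOut) (z z' : A.Past × A.Future) :
    L'.boxChoi (extendMap J Φ) ((J.extend a, (outEmbedding J).extend b), z)
        ((J.extend c, (outEmbedding J).extend d), z') =
      L.boxChoi Φ ((a, b), z) ((c, d), z') := by
  classical
  have hU : UnusedEq J (L'.boxIn z.1 ((outEmbedding J).extend b))
      (L'.boxIn z'.1 ((outEmbedding J).extend d)) := fun w hw =>
    ((outEmbedding J).extend_of_not_isUsed b hw).trans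
      ((outEmbedding J).extend_of_not_isUsed d hw).symm
  simp only [boxChoi, choi, Matrix.of_apply, extendMap, LinearMap.comp_apply, discard,
    pushTrace_single, if_pos hU, restrictIn_boxIn, SlotEmbedding.restrict_extend]
  rw [← extendOut_boxOut, ← extendOut_boxOut, addVacuum_extendOut]

/-- Composition with the extended box, for agents that answer the vacuum by the vacuum. -/
theorem linkProduct_extendMap
    {X : Matrix (L'.AgentIn × L'.AgentOut) (L'.AgentIn × L'.AgentOut) ℂ}
    (hX : ∀ a b c d, X (J.extend a, b) (J.extend c, d) ≠ 0 →
      ∀ w, ¬ (outEmbedding J).IsUsed w → b w = none ∧ d w = none) :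
    linkProduct X (L'.boxChoi (extendMap J Φ)) =
      linkProduct (X.submatrix (Prod.map J.extend (outEmbedding J).extend)
        (Prod.map J.extend (outEmbedding J).extend)) (L.boxChoi Φ) := by
  -- In a nonzero term the box forces the vacuum on unused wires to the agents, and then `hX` forces
  -- it on their answers. Only extended states remain in the sum.
  have key : ∀ y y' z z', X y y' * L'.boxChoi (extendMap J Φ) (y, z) (y', z') ≠ 0 →
      (y ∈ Set.range (Prod.map J.extend (outEmbedding J).extend)) ∧
      (y' ∈ Set.range (Prod.map J.extend (outEmbedding J).extend)) := by
    rintro ⟨a, b⟩ ⟨c, d⟩ z z' h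
    obtain ⟨⟨a, rfl⟩, ⟨c, rfl⟩⟩ := boxChoi_extendMap_ne_zero J Φ (right_ne_zero_of_mul h)
    have h' := hX _ _ _ _ (left_ne_zero_of_mul h)
    exact ⟨⟨(a, (outEmbedding J).restrict b),
        Prod.ext rfl ((outEmbedding J).extend_restrict fun w hw => (h' w hw).1)⟩,
      ⟨(c, (outEmbedding J).restrict d),
        Prod.ext rfl ((outEmbedding J).extend_restrict fun w hw => (h' w hw).2)⟩⟩
  have inj : Function.Injective (Prod.map (J.extend (B := A.Inp))
      ((outEmbedding J).extend (B := A.Out))) :=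
    J.extend_injective.prodMap (outEmbedding J).extend_injective
  ext z z'
  simp only [linkProduct, Matrix.of_apply]
  refine (Fintype.sum_of_injective _ inj _ _ ?_ ?_).symm
  · intro y hy
    refine Finset.sum_eq_zero fun y' _ => ?_
    by_contra h
    exact hy (key _ _ _ _ h).1
  · intro y
    refine Fintype.sum_of_injective _ inj _ _ ?_ ?_
    · intro y' hy'
      by_contra h
      exact hy' (key _ _ _ _ h).2
    · intro y'
      rw [Matrix.submatrix_apply]
      exact congrArg _ (boxChoi_extendMap_extend J Φ _ _ _ _ z z').symm

/-- The operation of an agent on the slots in use. -/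
def restrictOperation {i : A.Agent} (M : LocalOperation L' i) : LocalOperation L i where
  op t := M.op (J.emb i t)
  completelyPositive _ := M.completelyPositive _
  traceNonincreasing _ := M.traceNonincreasing _
  localOrder _ := M.localOrder _
  active _ := M.active _

/-- An agent acts on each slot of the larger set as on the slot that it retracts to. -/
def extendOperation {i : A.Agent} (M : LocalOperation L i) : LocalOperation L' i where
  op t := M.op (J.ret i t)
  completelyPositive _ := M.completelyPositive _
  traceNonincreasing _ := M.traceNonincreasing _
  localOrder _ := M.localOrder _
  active _ := M.active _

theorem restrictOperation_extendOperation {i : A.Agent} (M : LocalOperation L i) :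
    restrictOperation J (extendOperation J M) = M := by
  simp only [restrictOperation, extendOperation, J.ret_emb]

/-- Local order enters here: it determines the factor of every unused slot. -/
theorem choi_vacuum {i : A.Agent} (M : LocalOperation L i) (t : {t // t ∈ L.inp i})
    (y y' : Option (A.Out i)) :
    choi (M.op t) (none, y) (none, y') = if none = y ∧ none = y' then 1 else 0 := by
  rw [choi, Matrix.of_apply, M.localOrder, Matrix.single_apply]

theorem agentsChoi_extend_ne_zero {M : ∀ i, LocalOperation L' i} {a c : L.AgentIn}
    {b d : L'.AgentOut} (h : L'.agentsChoi M (J.extend a, b) (J.extend c, d) ≠ 0)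
    (w : L'.OutWire) (hw : ¬ (outEmbedding J).IsUsed w) : b w = none ∧ d w = none := by
  obtain ⟨w, rfl⟩ := L'.answer_bijective.2 w
  rw [isUsed_answer] at hw
  simp only [agentsChoi, Matrix.of_apply] at h
  have hf := Finset.prod_ne_zero_iff.1 h w (Finset.mem_univ _)
  rw [J.extend_of_not_isUsed _ hw, J.extend_of_not_isUsed _ hw] at hf
  have aux : ∀ y y' : Option (A.Out w.1), choi ((M w.1).op w.2) (none, y) (none, y') ≠ 0 →
      y = none ∧ y' = none := by
    intro y y' hy
    rw [choi_vacuum] at hy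
    exact (ite_ne_right_iff.1 hy).1.imp Eq.symm Eq.symm
  exact aux _ _ hf

/-- An unused slot contributes its vacuum-to-vacuum entry, which is 1 whatever the operation there.
-/
theorem agentsChoi_extend (M : ∀ i, LocalOperation L' i) (a c : L.AgentIn) (b d : L.AgentOut) :
    L'.agentsChoi M (J.extend a, (outEmbedding J).extend b)
        (J.extend c, (outEmbedding J).extend d) =
      L.agentsChoi (fun i => restrictOperation J (M i)) (a, b) (c, d) := by
  simp only [agentsChoi, Matrix.of_apply]
  refine (Fintype.prod_of_injective J.toWire J.toWire_injective _ _ ?_ ?_).symm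
  · intro w hw
    have hw' : ¬ J.IsUsed w := fun h => hw (J.isUsed_iff.1 h)
    have hw'' : ¬ (outEmbedding J).IsUsed (L'.answer w) := by rwa [isUsed_answer]
    rw [J.extend_of_not_isUsed _ hw', J.extend_of_not_isUsed _ hw']
    exact (choi_vacuum (M w.1) w.2 _ _).trans
      (if_pos ⟨((outEmbedding J).extend_of_not_isUsed b hw'').symm,
        ((outEmbedding J).extend_of_not_isUsed d hw'').symm⟩)
  · intro w
    have h : ∀ e : L.AgentOut,
        (outEmbedding J).extend e (L'.answer (J.toWire w)) = e (L.answer w) := by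
      intro e
      have aux : ∀ p q : {t // t ∈ L'.out w.1}, p = q →
          ((outEmbedding J).extend e ⟨w.1, p⟩ : Option (A.Out w.1)) =
            (outEmbedding J).extend e ⟨w.1, q⟩ := by
        rintro p _ rfl
        rfl
      refine (aux (L'.answer (J.toWire w)).2 ((outEmbedding J).toWire (L.answer w)).2 ?_).trans
        ((outEmbedding J).extend_toWire e (L.answer w))
      simp [outEmbedding, answer, SlotEmbedding.toWire]
    rw [J.extend_toWire, J.extend_toWire, h, h]
    rfl

theorem compose_extendMap (M : ∀ i, LocalOperation L' i) :
    L'.compose (extendMap J Φ) M = L.compose Φ (fun i => restrictOperation J (M i)) := by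
  rw [compose, linkProduct_extendMap J Φ fun a b c d h => agentsChoi_extend_ne_zero J h, compose]
  congr 1
  ext ⟨a, b⟩ ⟨c, d⟩
  exact agentsChoi_extend J M a c b d

theorem hasPattern_extend_iff (s : L'.InWire → Bool) (r : L'.OutWire → Bool) (a : L.AgentIn)
    (b : L.AgentOut) :
    L'.HasPattern s r (J.extend a, (outEmbedding J).extend b) ↔
      ((∀ w, ¬ J.IsUsed w → s w = false) ∧ ∀ w, ¬ (outEmbedding J).IsUsed w → r w = false) ∧
        L.HasPattern (s ∘ J.toWire) (r ∘ (outEmbedding J).toWire) (a, b) := by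
  constructor
  · rintro ⟨h1, h2⟩
    refine ⟨⟨fun w hw => ?_, fun w hw => ?_⟩, fun w => ?_, fun w => ?_⟩
    · exact (h1 w).symm.trans (congrArg Option.isSome (J.extend_of_not_isUsed a hw))
    · exact (h2 w).symm.trans
        (congrArg Option.isSome ((outEmbedding J).extend_of_not_isUsed b hw))
    · exact (congrArg Option.isSome (J.extend_toWire a w)).symm.trans (h1 _)
    · exact (congrArg Option.isSome ((outEmbedding J).extend_toWire b w)).symm.trans (h2 _)
  · rintro ⟨⟨h1, h2⟩, h3, h4⟩
    refine ⟨fun w => ?_, fun w => ?_⟩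
    · by_cases hw : J.IsUsed w
      · obtain ⟨w, rfl⟩ := J.isUsed_iff.1 hw
        exact (congrArg Option.isSome (J.extend_toWire a w)).trans (h3 w)
      · exact (congrArg Option.isSome (J.extend_of_not_isUsed a hw)).trans (h1 w hw).symm
    · by_cases hw : (outEmbedding J).IsUsed w
      · obtain ⟨w, rfl⟩ := (outEmbedding J).isUsed_iff.1 hw
        exact (congrArg Option.isSome ((outEmbedding J).extend_toWire b w)).trans (h4 w)
      · exact (congrArg Option.isSome ((outEmbedding J).extend_of_not_isUsed b hw)).trans
          (h2 w hw).symm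

-- Source of both the exactly-one condition and the bound on received messages: a pattern with a
-- message on an unused wire meets no extended state, and any other pattern is one of the old box.
open Classical in
theorem composeBranch_extendMap (M : ∀ i, LocalOperation L' i) (s : L'.InWire → Bool)
    (r : L'.OutWire → Bool) :
    L'.composeBranch (extendMap J Φ) M s r =
      if (∀ w, ¬ J.IsUsed w → s w = false) ∧ ∀ w, ¬ (outEmbedding J).IsUsed w → r w = false then
        L.composeBranch Φ (fun i => restrictOperation J (M i)) (s ∘ J.toWire)
          (r ∘ (outEmbedding J).toWire)
      else 0 := by
  rw [composeBranch, linkProduct_extendMap]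
  · split_ifs with h
    · have hp := fun a b => (hasPattern_extend_iff J s r a b).trans (and_iff_right h)
      rw [composeBranch]
      congr 1
      ext ⟨a, b⟩ ⟨c, d⟩
      simp only [Matrix.submatrix_apply, Prod.map, Matrix.of_apply, hp, agentsChoi_extend]
    · ext z z'
      simp only [linkProduct, Matrix.submatrix_apply, Prod.map, Matrix.of_apply,
        hasPattern_extend_iff, h, false_and, if_false, zero_mul, Finset.sum_const_zero,
        Matrix.zero_apply]
  · intro a b c d h
    rw [Matrix.of_apply] at h
    exact agentsChoi_extend_ne_zero J (ite_ne_right_iff.1 h).2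

end Positions

/-! ### Causality -/

/-- The points strictly below some point of a cut. -/
def strictLower {T : Type*} [PartialOrder T] (C : LowerSet T) : LowerSet T where
  carrier := {x | ∃ y ∈ C, x < y}
  lower' := by
    rintro x z hz ⟨y, hy, hxy⟩
    exact ⟨y, hy, lt_of_le_of_lt hz hxy⟩

theorem mem_strictLower {T : Type*} [PartialOrder T] {C : LowerSet T} {x : T} :
    x ∈ strictLower C ↔ ∃ y ∈ C, x < y := Iff.rfl

theorem isCausalityFunction_strictLower (m : ℕ) :
    IsCausalityFunction (strictLower : LowerSet (Steps m) → LowerSet (Steps m)) := by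
  have hle : ∀ C : LowerSet (Steps m), strictLower C ≤ C := by
    rintro C x ⟨y, hy, hxy⟩
    exact C.lower hxy.le hy
  -- Each application lowers the largest possible position by at least one.
  have iter : ∀ (C : LowerSet (Steps m)) (n : ℕ) (x : Steps m),
      x ∈ strictLower^[n] C → (x : ℕ) + n ≤ m := by
    intro C n
    induction n with
    | zero => exact fun x _ => (Finset.mem_Icc.1 x.2).2
    | succ n ih =>
      intro x hx
      rw [Function.iterate_succ_apply'] at hx
      obtain ⟨y, hy, hxy⟩ := hx
      have h1 := ih y hy
      have h2 : (x : ℕ) < y := hxy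
      omega
  have exhaust : ∀ (C : LowerSet (Steps m)), ∀ t ∈ C, ∃ n : ℕ, t ∉ strictLower^[n] C := by
    intro C t _
    refine ⟨m, fun h => ?_⟩
    have h1 := iter C m t h
    have h2 := (Finset.mem_Icc.1 t.2).1
    omega
  refine ⟨fun C D => ?_, ?_, fun C _ hC => ?_, fun C _ => exhaust C⟩
  · ext x
    simp only [SetLike.mem_coe, LowerSet.mem_sup_iff, mem_strictLower, or_and_right, exists_or]
  · rintro C D h x ⟨y, hy, hxy⟩
    exact ⟨y, h hy, hxy⟩
  -- A fixed cut would survive all iterations, against `exhaust`.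
  · refine lt_of_le_of_ne (hle C) fun h => hC ?_
    ext t
    simp only [SetLike.mem_coe, LowerSet.notMem_bot, iff_false]
    intro ht
    obtain ⟨n, hn⟩ := exhaust C t ht
    rw [Function.iterate_fixed h] at hn
    exact hn ht

/-! ### Causality of the extended box -/

namespace Positions

variable {A : AgentSpaces.{u}} {T T' : Type v} [PartialOrder T] [PartialOrder T'] [DecidableEq T]
  [DecidableEq T'] {L : Positions A T} {L' : Positions A T'}
  (J : SlotEmbedding (fun i => {t // t ∈ L.inp i}) (fun i => {t // t ∈ L'.inp i}))

/-- Every wire of `K` comes from one in `K'`, so the composite forgets at least as much as the trace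
onto `K'`. -/
theorem partialTrace_discard {K : Set (Option L.OutWire)} {K' : Set (Option L'.OutWire)}
    (h : ∀ w ∈ K, w.map (outEmbedding J).toWire ∈ K') {ρ ρ' : Matrix L'.BoxIn L'.BoxIn ℂ}
    (hρ : partialTrace K' ρ = partialTrace K' ρ') :
    partialTrace K (discard J ρ) = partialTrace K (discard J ρ') := by
  classical
  rw [partialTrace_eq_pushTrace, partialTrace_eq_pushTrace] at hρ
  rw [partialTrace_eq_pushTrace, partialTrace_eq_pushTrace, discard, pushTrace_pushTrace,
    pushTrace_pushTrace]
  refine pushTrace_congr (fun u v huv => ?_) (fun u v huv w hw => ?_)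
    (fun u v u' v' huv hu hv huv' => ⟨fun w hw => ?_, fun w hw => ?_⟩) hρ
  · funext ⟨w, hw⟩
    cases w with
    | none => exact congrFun huv ⟨none, h none hw⟩
    | some w => exact congrFun huv ⟨some ((outEmbedding J).toWire w), h _ hw⟩
  · cases w with
    | none => exact huv.2 none fun hK => hw (h _ hK)
    | some w =>
      by_cases hw' : (outEmbedding J).IsUsed w
      · obtain ⟨w, rfl⟩ := (outEmbedding J).isUsed_iff.1 hw'
        exact huv.2 (some w) fun hK => hw (h _ hK)
      · exact huv.1 w hw'
  · by_cases hw' : some w ∈ K'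
    · exact (congrFun hu ⟨_, hw'⟩).symm.trans ((huv'.1 w hw).trans (congrFun hv ⟨_, hw'⟩))
    · exact huv _ hw'
  · cases w with
    | none =>
      by_cases hw' : none ∈ K'
      · exact (congrFun hu ⟨_, hw'⟩).symm.trans ((huv'.2 none hw).trans (congrFun hv ⟨_, hw'⟩))
      · exact huv _ hw'
    | some w =>
      by_cases hw' : some ((outEmbedding J).toWire w) ∈ K'
      · exact (congrFun hu ⟨_, hw'⟩).symm.trans
          ((huv'.2 (some w) hw).trans (congrFun hv ⟨_, hw'⟩))
      · exact huv _ hw'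

/-- A wire kept in `K'` is either the image of one in `K` or carries the vacuum, hence no
information. -/
theorem partialTrace_addVacuum {K : Set (Option L.InWire)} {K' : Set (Option L'.InWire)}
    (h : ∀ w, w.map J.toWire ∈ K' → w ∈ K) {σ σ' : Matrix L.BoxOut L.BoxOut ℂ}
    (hσ : partialTrace K σ = partialTrace K σ') :
    partialTrace K' (addVacuum J σ) = partialTrace K' (addVacuum J σ') := by
  classical
  have hx : ∀ (u : L.BoxOut) (w : L.InWire), extendOut J u (some (J.toWire w)) = u (some w) :=
    fun u w => J.extend_toWire (fun w => u (some w)) w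
  have hx' : ∀ (u v : L.BoxOut) (w : L'.InWire), ¬ J.IsUsed w →
      extendOut J u (some w) = extendOut J v (some w) := fun u v w hw =>
    (J.extend_of_not_isUsed (fun w => u (some w)) hw).trans
      (J.extend_of_not_isUsed (fun w => v (some w)) hw).symm
  rw [partialTrace_eq_pushTrace, partialTrace_eq_pushTrace] at hσ
  rw [partialTrace_eq_pushTrace, partialTrace_eq_pushTrace, addVacuum, pushTrace_pushTrace,
    pushTrace_pushTrace]
  refine pushTrace_congr (fun u v huv => ?_) (fun u v huv w hw => ?_)
    (fun u v u' v' huv hu hv huv' => ⟨trivial, fun w hw => ?_⟩) hσ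
  · funext ⟨w, hw⟩
    cases w with
    | none => exact congrFun huv ⟨none, h none hw⟩
    | some w =>
      by_cases hw' : J.IsUsed w
      · obtain ⟨w, rfl⟩ := J.isUsed_iff.1 hw'
        exact (hx u w).trans ((congrFun huv ⟨some w, h (some w) hw⟩).trans (hx v w).symm)
      · exact hx' u v w hw'
  · cases w with
    | none => exact huv.2 none fun hK => hw (h none hK)
    | some w =>
      exact (hx u w).symm.trans ((huv.2 (some (J.toWire w)) fun hK => hw (h (some w) hK)).trans
        (hx v w))
  · cases w with
    | none =>
      by_cases hw' : none ∈ K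
      · exact (congrFun hu ⟨_, hw'⟩).symm.trans ((huv'.2 none hw).trans (congrFun hv ⟨_, hw'⟩))
      · exact huv _ hw'
    | some w =>
      by_cases hu' : J.IsUsed w
      · obtain ⟨w, rfl⟩ := J.isUsed_iff.1 hu'
        refine (hx u w).trans (Eq.trans ?_ (hx v w).symm)
        by_cases hw' : some w ∈ K
        · exact (congrFun hu ⟨_, hw'⟩).symm.trans ((hx u' w).symm.trans
            ((huv'.2 (some (J.toWire w)) hw).trans
              ((hx v' w).trans (congrFun hv ⟨_, hw'⟩))))
        · exact huv _ hw'
      · exact hx' u v w hu'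

/-- The position at which the box receives from a wire. -/
def inPosition (L : Positions A T) (w : Option L.OutWire) : T :=
  w.elim L.past fun w => (w.2 : T)

/-- The position at which the box sends to a wire. -/
def outPosition (L : Positions A T) (w : Option L.InWire) : T :=
  w.elim L.future fun w => (w.2 : T)

theorem causal_extendMap (htotal : ∀ s t : T, s ≤ t ∨ t ≤ s)
    (hJ : ∀ (w : Option L.OutWire) (w' : Option L.InWire), L.inPosition w < L.outPosition w' →
      L'.inPosition (w.map (outEmbedding J).toWire) < L'.outPosition (w'.map J.toWire))
    {Φ : Matrix L.BoxIn L.BoxIn ℂ →ₗ[ℂ] Matrix L.BoxOut L.BoxOut ℂ}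
    {χ : LowerSet T → LowerSet T} (hχ : IsCausalityFunction χ)
    (hΦ : ∀ (C : LowerSet T) (ρ ρ' : Matrix L.BoxIn L.BoxIn ℂ),
      partialTrace (L.boxInWires (χ C)) ρ = partialTrace (L.boxInWires (χ C)) ρ' →
      partialTrace (L.boxOutWires C) (Φ ρ) = partialTrace (L.boxOutWires C) (Φ ρ'))
    (C' : LowerSet T') (ρ ρ' : Matrix L'.BoxIn L'.BoxIn ℂ)
    (h : partialTrace (L'.boxInWires (strictLower C')) ρ =
      partialTrace (L'.boxInWires (strictLower C')) ρ') :
    partialTrace (L'.boxOutWires C') (extendMap J Φ ρ) =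
      partialTrace (L'.boxOutWires C') (extendMap J Φ ρ') := by
  -- The lower closure of the old output positions whose new images lie in `C'`. Adding `L.past`
  -- makes `C` nonempty, so that strictness of `χ` applies; it is harmless because nothing lies
  -- strictly below it.
  let C : LowerSet T :=
    { carrier := {t | t = L.past ∨ ∃ w, t ≤ L.outPosition w ∧ L'.outPosition (w.map J.toWire) ∈ C'}
      lower' := by
        rintro t s hst (rfl | ⟨w, hw, hw'⟩)
        · exact Or.inl (le_antisymm hst (L.past_le s))
        · exact Or.inr ⟨w, hst.trans hw, hw'⟩ }
  have hlt : χ C < C := by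
    refine hχ.strict C ⟨L.future, fun t _ => L.le_future t⟩ fun hC => ?_
    have : L.past ∈ C := Or.inl rfl
    rw [hC] at this
    exact LowerSet.notMem_bot this
  refine partialTrace_addVacuum J (K := L.boxOutWires C) (fun w hw => Or.inr ⟨w, le_rfl, ?_⟩)
    (hΦ C _ _ (partialTrace_discard J (fun w hw => ?_) h))
  · cases w <;> exact hw
  -- By totality, all of `χ C` lies strictly below any point `t` of `C` outside `χ C`.
  · obtain ⟨t, htC, htχ⟩ := Set.exists_of_ssubset (LowerSet.coe_ssubset_coe.2 hlt)
    have hw₀ : L.inPosition w ∈ χ C := hw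
    have hwt : L.inPosition w < t := by
      rcases htotal t (L.inPosition w) with hle | hle
      · exact absurd ((χ C).lower hle hw₀) htχ
      · exact lt_of_le_of_ne hle fun heq => htχ (heq ▸ hw₀)
    have hmem : L'.inPosition (w.map (outEmbedding J).toWire) ∈ strictLower C' := by
      rcases htC with rfl | ⟨w', hw', hC'⟩
      · exact absurd hwt (L.past_le _).not_gt
      · exact ⟨_, hC', hJ w w' (hwt.trans_le hw')⟩
    exact hmem

end Positions

/-! ### One slot for each agent and each step -/

/-- Positions in simple form with `k` pairs of an input and an output position. -/
def simplePositions (A : AgentSpaces.{u}) (k : ℕ) : Positions A (Steps (2 * k + 2)) where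
  inp _ := Finset.univ.filter fun t => Even (t : ℕ) ∧ (t : ℕ) < 2 * k + 2
  out _ := Finset.univ.filter fun t => Odd (t : ℕ) ∧ 1 < (t : ℕ)
  resp _ :=
    { toFun := fun t => ⟨⟨t.1.1 + 1, by
        have := (Finset.mem_filter.1 t.2).2
        simp only [Finset.mem_Icc]
        omega⟩, by
        have h := (Finset.mem_filter.1 t.2).2
        have h' := (Finset.mem_Icc.1 t.1.2).1
        simp only [Finset.mem_filter, Finset.mem_univ, true_and]
        exact ⟨h.1.add_one, by omega⟩⟩
      invFun := fun t => ⟨⟨t.1.1 - 1, by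
        have h := (Finset.mem_filter.1 t.2).2
        have h' := (Finset.mem_Icc.1 t.1.2).2
        simp only [Finset.mem_Icc]
        omega⟩, by
        have h := (Finset.mem_filter.1 t.2).2
        have h' := (Finset.mem_Icc.1 t.1.2).2
        simp only [Finset.mem_filter, Finset.mem_univ, true_and]
        exact ⟨h.1.tsub_odd odd_one, by omega⟩⟩
      left_inv := fun t => by
        ext
        simp
      right_inv := fun t => by
        have h := (Finset.mem_filter.1 t.2).2
        ext
        simp only
        omega }
  lt_resp _ t := Nat.lt_succ_self (t.1 : ℕ)
  past := ⟨1, by simp⟩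
  past_le t := (Finset.mem_Icc.1 t.2).1
  future := ⟨2 * k + 2, by simp⟩
  le_future t := (Finset.mem_Icc.1 t.2).2

theorem mem_simplePositions_inp {A : AgentSpaces.{u}} {k : ℕ} {i : A.Agent}
    {t : Steps (2 * k + 2)} :
    t ∈ (simplePositions A k).inp i ↔ Even (t : ℕ) ∧ (t : ℕ) < 2 * k + 2 := by
  simp [simplePositions]

theorem mem_simplePositions_out {A : AgentSpaces.{u}} {k : ℕ} {i : A.Agent}
    {t : Steps (2 * k + 2)} :
    t ∈ (simplePositions A k).out i ↔ Odd (t : ℕ) ∧ 1 < (t : ℕ) := by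
  simp [simplePositions]

section

variable {A : AgentSpaces.{u}} {n : ℕ} (L : Positions A (Steps (2 * n + 2)))
  (hL : ∀ i, ∀ t : Steps (2 * n + 2), t ∈ L.inp i ↔ Even (t : ℕ) ∧ (t : ℕ) < 2 * n + 2)

/-- The number of an agent in a fixed enumeration of the agents. -/
noncomputable def agentIndex (i : A.Agent) : ℕ := Fintype.equivFin A.Agent i

theorem agentIndex_lt (i : A.Agent) : agentIndex i < Fintype.card A.Agent :=
  (Fintype.equivFin A.Agent i).2

theorem agentIndex_injective : Function.Injective (agentIndex (A := A)) :=
  Fin.val_injective.comp (Fintype.equivFin A.Agent).injective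

/-- The block number is at most n - 1, so the pair number bN + p is below nN. -/
theorem slot_lt {n t N p : ℕ} (h₀ : 1 ≤ t) (h : Even t ∧ t < 2 * n + 2) (hp : p < N) :
    2 + 2 * ((t - 2) / 2 * N + p) < 2 * (n * N) + 2 := by
  obtain ⟨⟨c, rfl⟩, h⟩ := h
  have hb : (c + c - 2) / 2 + 1 ≤ n := by omega
  have := Nat.mul_le_mul_right N hb
  rw [add_mul, one_mul] at this
  omega

theorem slot_div_lt {n t N : ℕ} (h₀ : 1 ≤ t) (h : Even t ∧ t < 2 * (n * N) + 2) :
    (t - 2) / 2 / N < n := by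
  obtain ⟨⟨c, rfl⟩, h⟩ := h
  refine Nat.div_lt_of_lt_mul ?_
  rw [mul_comm N n]
  omega

/-- The step `2 + 2 b` is replaced by one step for each agent. -/
noncomputable def sequentialEmbedding :
    SlotEmbedding (fun i => {t // t ∈ L.inp i})
      (fun i => {t // t ∈ (simplePositions A (n * Fintype.card A.Agent)).inp i}) where
  emb i t := ⟨⟨2 + 2 * ((t.1.1 - 2) / 2 * Fintype.card A.Agent + agentIndex i), by
      have := slot_lt (Finset.mem_Icc.1 t.1.2).1 ((hL i t.1).1 t.2) (agentIndex_lt i)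
      simp only [Finset.mem_Icc]
      omega⟩, by
      have := slot_lt (Finset.mem_Icc.1 t.1.2).1 ((hL i t.1).1 t.2) (agentIndex_lt i)
      rw [mem_simplePositions_inp]
      exact ⟨(even_two.add (even_two_mul _)), by simp only; omega⟩⟩
  -- The pair number divided by N is the block number; N is positive because `i` is an agent.
  ret i t := ⟨⟨2 + 2 * ((t.1.1 - 2) / 2 / Fintype.card A.Agent), by
      have := slot_div_lt (Finset.mem_Icc.1 t.1.2).1 (mem_simplePositions_inp.1 t.2)
      simp only [Finset.mem_Icc]
      omega⟩, by
      have := slot_div_lt (Finset.mem_Icc.1 t.1.2).1 (mem_simplePositions_inp.1 t.2)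
      rw [hL]
      exact ⟨(even_two.add (even_two_mul _)), by simp only; omega⟩⟩
  ret_emb i t := by
    have h := (hL i t.1).1 t.2
    have h1 := (Finset.mem_Icc.1 t.1.2).1
    have hi := agentIndex_lt i
    ext
    simp only [Nat.add_sub_cancel_left, Nat.mul_div_cancel_left _ (Nat.succ_pos 1)]
    rw [add_comm _ (agentIndex i), Nat.add_mul_div_right _ _ (by omega), Nat.div_eq_of_lt hi]
    obtain ⟨c, hc⟩ := h.1
    omega

theorem sequentialEmbedding_toWire_val (w : L.InWire) :
    (((sequentialEmbedding L hL).toWire w).2.1 : ℕ) =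
      2 + 2 * (((w.2.1 : ℕ) - 2) / 2 * Fintype.card A.Agent + agentIndex w.1) := rfl

theorem outEmbedding_toWire_answer_val (w : L.InWire) :
    (((Positions.outEmbedding (sequentialEmbedding L hL)).toWire (L.answer w)).2.1 : ℕ) =
      2 + 2 * (((w.2.1 : ℕ) - 2) / 2 * Fintype.card A.Agent + agentIndex w.1) + 1 := by
  rw [Positions.toWire_answer]
  rfl

/-- The remainder modulo N of a pair number is the agent served there. -/
theorem agent_eq_of_mod_eq {N a b p q : ℕ} (hp : p < N) (hq : q < N)
    (h : a * N + p = b * N + q) : p = q := by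
  have := congrArg (· % N) h
  simpa [Nat.add_mod, Nat.mod_eq_of_lt hp, Nat.mod_eq_of_lt hq] using this

/-- Two used input wires at the same position are equal. -/
theorem inWire_eq_of_isUsed {w w' : (simplePositions A (n * Fintype.card A.Agent)).InWire}
    (hw : (sequentialEmbedding L hL).IsUsed w) (hw' : (sequentialEmbedding L hL).IsUsed w')
    (h : (w.2 : Steps (2 * (n * Fintype.card A.Agent) + 2)) = w'.2) : w = w' := by
  obtain ⟨v, rfl⟩ := (SlotEmbedding.isUsed_iff _).1 hw
  obtain ⟨v', rfl⟩ := (SlotEmbedding.isUsed_iff _).1 hw'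
  have hv := congrArg Subtype.val h
  rw [sequentialEmbedding_toWire_val, sequentialEmbedding_toWire_val] at hv
  have hi : v.1 = v'.1 := agentIndex_injective
    (agent_eq_of_mod_eq (agentIndex_lt _) (agentIndex_lt _) (Nat.eq_of_mul_eq_mul_left two_pos
      (Nat.add_left_cancel hv)))
  obtain ⟨i, t⟩ := v
  obtain ⟨i', t'⟩ := v'
  obtain rfl : i = i' := hi
  exact Sigma.ext rfl (heq_of_eq (Subtype.ext h))

/-- Two used output wires at the same position are equal. -/
theorem outWire_eq_of_isUsed {w w' : (simplePositions A (n * Fintype.card A.Agent)).OutWire}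
    (hw : (Positions.outEmbedding (sequentialEmbedding L hL)).IsUsed w)
    (hw' : (Positions.outEmbedding (sequentialEmbedding L hL)).IsUsed w')
    (h : (w.2 : Steps (2 * (n * Fintype.card A.Agent) + 2)) = w'.2) : w = w' := by
  obtain ⟨w, rfl⟩ := Positions.answer_bijective _ |>.2 w
  obtain ⟨w', rfl⟩ := Positions.answer_bijective _ |>.2 w'
  rw [Positions.isUsed_answer] at hw hw'
  have hv : (w.2.1 : ℕ) + 1 = (w'.2.1 : ℕ) + 1 := congrArg Subtype.val h
  rw [inWire_eq_of_isUsed L hL hw hw' (Subtype.ext (Nat.add_right_cancel hv))]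

theorem card_filter_le_one {W : Type*} [Fintype W] {p : W → Prop} [DecidablePred p]
    (h : ∀ w w', p w → p w' → w = w') : (Finset.univ.filter p).card ≤ 1 :=
  Finset.card_le_one.2 fun w hw w' hw' =>
    h w w' (Finset.mem_filter.1 hw).2 (Finset.mem_filter.1 hw').2

/-- An old answer in block b that precedes an old output in block b' forces b + 1 ≤ b', whence bN +
p < (b + 1)N ≤ b'N. -/
theorem sequentialEmbedding_lt
    (hresp : ∀ i t, ((L.resp i t : Steps (2 * n + 2)) : ℕ) = (t : Steps (2 * n + 2)) + 1)
    (w : Option L.OutWire) (w' : Option L.InWire) (h : L.inPosition w < L.outPosition w') :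
    (simplePositions A (n * Fintype.card A.Agent)).inPosition
        (w.map (Positions.outEmbedding (sequentialEmbedding L hL)).toWire) <
      (simplePositions A (n * Fintype.card A.Agent)).outPosition
        (w'.map (sequentialEmbedding L hL).toWire) := by
  have hout : ∀ v : L.InWire, (((sequentialEmbedding L hL).toWire v).2.1 : ℕ) <
      2 * (n * Fintype.card A.Agent) + 2 := fun v => (mem_simplePositions_inp.1
        ((sequentialEmbedding L hL).toWire v).2.2).2
  cases w with
  | none =>
    cases w' with
    | none => exact (by omega : (1 : ℕ) < 2 * (n * Fintype.card A.Agent) + 2)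
    | some v =>
      refine (?_ : (1 : ℕ) < (((sequentialEmbedding L hL).toWire v).2.1 : ℕ))
      rw [sequentialEmbedding_toWire_val]
      omega
  | some w =>
    obtain ⟨w, rfl⟩ := L.answer_bijective.2 w
    cases w' with
    | none =>
      refine (?_ : (((Positions.outEmbedding (sequentialEmbedding L hL)).toWire
        (L.answer w)).2.1 : ℕ) < 2 * (n * Fintype.card A.Agent) + 2)
      have := hout w
      rw [sequentialEmbedding_toWire_val] at this
      rw [outEmbedding_toWire_answer_val]
      omega
    | some v =>
      refine (?_ : (((Positions.outEmbedding (sequentialEmbedding L hL)).toWire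
        (L.answer w)).2.1 : ℕ) < (((sequentialEmbedding L hL).toWire v).2.1 : ℕ))
      have h' : ((L.resp w.1 w.2).1 : ℕ) < (v.2.1 : ℕ) := h
      rw [hresp] at h'
      rw [outEmbedding_toWire_answer_val, sequentialEmbedding_toWire_val]
      have hb : ((w.2.1 : ℕ) - 2) / 2 + 1 ≤ ((v.2.1 : ℕ) - 2) / 2 := by
        obtain ⟨c, hc⟩ := ((hL _ _).1 w.2.2).1
        obtain ⟨d, hd⟩ := ((hL _ _).1 v.2.2).1
        have := (Finset.mem_Icc.1 w.2.1.2).1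
        omega
      have := Nat.mul_le_mul_right (Fintype.card A.Agent) hb
      rw [add_mul, one_mul] at this
      have := agentIndex_lt w.1
      omega

end

/-! ### The sequential box and its properties -/

section

variable {A : AgentSpaces.{u}} {n : ℕ} (Φ : ProcessBox A (Steps (2 * n + 2)))
  (hΦ : Φ.HasSimpleForm)

/-- The process box that sends to the agents one after the other. -/
noncomputable def sequentialBox : ProcessBox A (Steps (2 * (n * Fintype.card A.Agent) + 2)) where
  pos := simplePositions A (n * Fintype.card A.Agent)
  map := Positions.extendMap (sequentialEmbedding Φ.pos fun i => (hΦ.2.2.2 i).1) Φ.map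
  completelyPositive := Positions.isCompletelyPositive_extendMap _ _ Φ.completelyPositive
  tracePreserving := Positions.isTracePreserving_extendMap _ _ Φ.tracePreserving
  causal := by
    obtain ⟨χ, hχ, h⟩ := Φ.causal
    refine ⟨strictLower, isCausalityFunction_strictLower _, ?_⟩
    intro C ρ ρ' hρ
    refine Positions.causal_extendMap (sequentialEmbedding Φ.pos fun i => (hΦ.2.2.2 i).1)
      ?_ ?_ hχ h C ρ ρ' hρ
    · intro s t
      exact Nat.le_total s t
    · exact sequentialEmbedding_lt _ _ fun i => (hΦ.2.2.2 i).2.2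
  exactlyOne := by
    rintro M s r ⟨i, hi⟩
    classical
    rw [Positions.composeBranch_extendMap]
    split_ifs with hsr
    -- The pattern has messages on used slots only, and these correspond to the old slots, so each
    -- agent's message count is unchanged.
    · refine Φ.exactlyOne _ _ _ ⟨i, fun hcard => hi ?_⟩
      refine Eq.trans ?_ hcard
      set J := sequentialEmbedding Φ.pos fun i => (hΦ.2.2.2 i).1
      refine (Finset.card_bij (fun t _ => J.emb i t) ?_ ?_ ?_).symm
      · intro t ht
        exact Finset.mem_filter.2 ⟨Finset.mem_univ _, (Finset.mem_filter.1 ht).2⟩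
      · intro t _ t' _ h
        rw [← J.ret_emb i t, h, J.ret_emb]
      · intro t ht
        have ht' : s ⟨i, t⟩ = true := (Finset.mem_filter.1 ht).2
        have hu : J.IsUsed ⟨i, t⟩ := by
          by_contra hu
          rw [hsr.1 _ hu] at ht'
          exact Bool.false_ne_true ht'
        have hu' : J.emb i (J.ret i t) = t := hu
        refine ⟨J.ret i t, Finset.mem_filter.2 ⟨Finset.mem_univ _, ?_⟩, hu'⟩
        exact (congrArg (fun t => s ⟨i, t⟩) hu').trans ht'
    · rfl

theorem sequentialBox_hasSimpleForm : (sequentialBox Φ hΦ).HasSimpleForm :=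
  ⟨(even_two_mul _).add even_two, rfl, rfl, fun _ =>
    ⟨fun _ => mem_simplePositions_inp, fun _ => mem_simplePositions_out, fun _ => rfl⟩⟩

theorem sequentialBox_sendsAtMostOne : (sequentialBox Φ hΦ).SendsAtMostOne := by
  intro ρ a f t ht
  by_contra h
  obtain ⟨⟨a, rfl⟩, -⟩ := Positions.addVacuum_ne_zero _ h
  refine ht.not_ge ?_
  split_ifs with hf
  -- The last position is reserved for the global future: no agent has an input wire there.
  · refine Nat.add_le_add_right (Nat.le_zero.2 ?_) 1
    rw [Finset.card_eq_zero, Finset.filter_eq_empty_iff]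
    rintro w - ⟨hw, -⟩
    have h1 := (mem_simplePositions_inp.1 w.2.2).2
    rw [hw, hf] at h1
    exact lt_irrefl _ h1
  · refine card_filter_le_one fun w w' hw hw' => ?_
    have used : ∀ w, (SlotEmbedding.extend
        (sequentialEmbedding Φ.pos fun i => (hΦ.2.2.2 i).1) a w).isSome = true →
        (sequentialEmbedding Φ.pos fun i => (hΦ.2.2.2 i).1).IsUsed w := by
      intro w hw
      by_contra hu
      rw [SlotEmbedding.extend_of_not_isUsed _ _ hu] at hw
      exact Bool.false_ne_true hw
    exact inWire_eq_of_isUsed _ _ (used w hw.2) (used w' hw'.2) (hw.1.trans hw'.1.symm)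

theorem sequentialBox_receivesAtMostOne : (sequentialBox Φ hΦ).ReceivesAtMostOne := by
  classical
  intro M s r t ht
  -- A branch that is not trivially zero has messages on used wires only, so two at one position are
  -- impossible.
  refine (Positions.composeBranch_extendMap _ _ _ _ _).trans (if_neg fun hsr => ht.not_ge ?_)
  split_ifs with hp
  · refine Nat.add_le_add_right (Nat.le_zero.2 ?_) 1
    rw [Finset.card_eq_zero, Finset.filter_eq_empty_iff]
    rintro w - ⟨hw, -⟩
    have h1 := (mem_simplePositions_out.1 w.2.2).2
    rw [hw, hp] at h1
    exact lt_irrefl _ h1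
  · refine card_filter_le_one fun w w' hw hw' => ?_
    have used : ∀ w, r w = true → (Positions.outEmbedding
        (sequentialEmbedding Φ.pos fun i => (hΦ.2.2.2 i).1)).IsUsed w := by
      intro w hw
      by_contra hu
      rw [hsr.2 _ hu] at hw
      exact Bool.false_ne_true hw
    exact outWire_eq_of_isUsed _ _ (used w hw.2) (used w' hw'.2) (hw.1.trans hw'.1.symm)

theorem operationallyEquivalent_sequentialBox :
    Φ.OperationallyEquivalent (sequentialBox Φ hΦ) := by
  refine ⟨Equiv.refl _, fun _ M => Positions.extendOperation
    (sequentialEmbedding Φ.pos fun i => (hΦ.2.2.2 i).1) M, 1, 1, ⟨by simp, by simp⟩,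
    ⟨by simp, by simp⟩, fun M => ?_⟩
  rw [Matrix.one_kronecker_one, Matrix.one_mul, Matrix.conjTranspose_one, Matrix.mul_one]
  refine (Positions.compose_extendMap _ _ _).trans ?_
  exact congrArg (Φ.pos.compose Φ.map)
    (funext fun i => Positions.restrictOperation_extendOperation _ (M i))

end

theorem mainTheorem8 (A : AgentSpaces.{u}) (m : ℕ) (Φ : ProcessBox A (Steps m))
    (hΦ : Φ.HasSimpleForm) :
    ∃ (m' : ℕ) (Φ' : ProcessBox A (Steps m')),
      Φ'.HasSimpleForm ∧ Φ'.SendsAtMostOne ∧ Φ'.ReceivesAtMostOne ∧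
      Φ.OperationallyEquivalent Φ' := by
  -- `m` is even, and positive because it bounds the position of the global past; n counts the pairs
  -- of agent positions.
  obtain ⟨n, rfl⟩ : ∃ n, m = 2 * n + 2 := by
    obtain ⟨c, hc⟩ := hΦ.1
    have := Finset.mem_Icc.1 Φ.pos.past.2
    exact ⟨c - 1, by omega⟩
  exact ⟨_, sequentialBox Φ hΦ, sequentialBox_hasSimpleForm Φ hΦ, sequentialBox_sendsAtMostOne Φ hΦ,
    sequentialBox_receivesAtMostOne Φ hΦ, operationallyEquivalent_sequentialBox Φ hΦ⟩
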